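/- Let $V(z,x)$, $z,x\in\mathbb R$, be a real, square-integrable, mean-zero, stationary random potential whose covariance $z\mapsto\mathbb E[V(0,0)V(z,x)]$ is integrable for every $x$, and put $\gamma(x)=\int_{\mathbb R}\mathbb E[V(0,0)V(z,x)]\,dz$. Let $\alpha,\sigma,\ell_c>0$, define $\tilde\gamma$ by $\gamma(x)=\sigma^2\ell_c\,\tilde\gamma(x/\ell_c)$, and set $$\tilde\Gamma=-\partial_{\tilde x}^2\tilde\gamma,\qquad \tilde\gamma_4=\partial_{\tilde x}^4\tilde\gamma(0),\qquad z_c=\frac{\ell_c}{2\sigma^{2/3}\alpha^{2/3}} .$$ (1) Assume $\gamma\in C^4(\mathbb R)$. Then $\tilde\gamma_4=-\partial_{\tilde x}^2\tilde\Gamma(0)$. Let $\rho_o>0$, let $\mathcal C_o:\mathbb R\to\mathbb C$ be any function with $\mathcal C_o(0)$ real and positive (the correlation function of the initial field), and put $\tilde{\mathcal C}_o(\tilde y)=\mathcal C_o(\rho_o\tilde y)$, $\tilde\pi_o=|\tilde{\mathcal C}_o|^2/\tilde{\mathcal C}_o(0)^2$, $X_o=\sigma^{2/3}\rho_o/\alpha^{1/3}$.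 Let $\tilde\Pi_{\tilde z}(\tilde x,\tilde y)$ be a classical solution, for $\tilde z\ge 0$, of $$\partial_{\tilde z}\tilde\Pi_{\tilde z}=i\,\partial^2_{\tilde x\tilde y}\tilde\Pi_{\tilde z}-\tfrac12\big(\tilde\Gamma(0)-\tilde\Gamma(\tilde x)\big)\tilde y^2\,\tilde\Pi_{\tilde z},\qquad \tilde\Pi_{0}(\tilde x,\tilde y)=\tilde\pi_o(\tilde y/X_o),$$ such that the derivatives $\partial_{\tilde x}^j\partial_{\tilde y}^k\tilde\Pi$ with $0\le j,k\le 3$ exist and are continuous on $[0,\infty)\times\mathbb R^2$. Define the (multiscale-limit) scintillation indices of the partially coherent (pc) and coherent (c) speckled beam by $$S_z^{(\mathrm{pc})}=\tilde\Pi_{z/z_c}(0,0)-1,\qquad S_z^{(\mathrm c)}=2\,\tilde\Pi_{z/z_c}(0,0)-1 .$$ Then, as $z\to0^+$, $$S_z^{(\mathrm{pc})}=\frac{\tilde\gamma_4}{6}\Big(\frac z{z_c}\Big)^3+o\Big(\Big(\frac z{z_c}\Big)^3\Big),\qquad S_z^{(\mathrm c)}=1+\frac{\tilde\gamma_4}{3}\Big(\frac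 z{z_c}\Big)^3+o\Big(\Big(\frac z{z_c}\Big)^3\Big).$$ (2) If the medium has Gaussian correlation function, $\mathbb E[V(0,0)V(z,x)]=\sigma^2\exp\big(-(x^2+z^2)/\ell_c^2\big)$, then $\tilde\gamma(\tilde x)=\sqrt\pi\,e^{-\tilde x^2}$ and $\tilde\gamma_4=12\sqrt\pi$. -/

import Mathlib

open MeasureTheory Filter Topology Set Asymptotics

noncomputable section

/-! ### The random medium -/

/-- A real random potential `V (z, x)` (with distribution carried by `μ`) that is square integrable,
centred, stationary (covariances are invariant under translations), and has an integrable
covariance function along the propagation axis. -/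
structure IsRandomPotential {Ω : Type*} [MeasurableSpace Ω] (μ : Measure Ω)
    (V : ℝ → ℝ → Ω → ℝ) : Prop where
  memLp : ∀ z x, MemLp (V z x) 2 μ
  mean_zero : ∀ z x, ∫ ω, V z x ω ∂μ = 0
  stationary : ∀ h k z x z' x',
    ∫ ω, V (z + h) (x + k) ω * V (z' + h) (x' + k) ω ∂μ = ∫ ω, V z x ω * V z' x' ω ∂μ
  integrable_cov : ∀ x, Integrable (fun z => ∫ ω, V 0 0 ω * V z x ω ∂μ)

/-- The integrated correlation function `γ(x) = ∫ E[V(0,0) V(z,x)] dz` of the medium. -/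
def mediumGamma {Ω : Type*} [MeasurableSpace Ω] (μ : Measure Ω) (V : ℝ → ℝ → Ω → ℝ)
    (x : ℝ) : ℝ :=
  ∫ z, ∫ ω, V 0 0 ω * V z x ω ∂μ

/-- The dimensionless profile `γ̃` of `γ`, i.e. `γ(x) = σ² ℓ γ̃(x / ℓ)`. -/
def normalizedGamma (σ ℓ : ℝ) (γ : ℝ → ℝ) (x : ℝ) : ℝ :=
  γ (ℓ * x) / (σ ^ 2 * ℓ)

/-- `Γ̃ = - ∂² γ̃`. -/
def capGamma (γt : ℝ → ℝ) (x : ℝ) : ℝ :=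
  -iteratedDeriv 2 γt x

/-- `γ̃₄ = ∂⁴ γ̃ (0)`. -/
def gammaFour (γt : ℝ → ℝ) : ℝ :=
  iteratedDeriv 4 γt 0

/-! ### The characteristic scales -/

/-- `z_c = ℓ / (2 σ^{2/3} α^{2/3})`. -/
def zCrit (α σ ℓ : ℝ) : ℝ :=
  ℓ / (2 * σ ^ (2 / 3 : ℝ) * α ^ (2 / 3 : ℝ))

/-- `X_o = σ^{2/3} ρ / α^{1/3}`. -/
def xInit (α σ ρ : ℝ) : ℝ :=
  σ ^ (2 / 3 : ℝ) * ρ / α ^ (1 / 3 : ℝ)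

/-! ### The initial field -/

/-- `π̃_o(y) = |C̃_o(y)|² / C̃_o(0)²`, where `C̃_o(y) = C_o(ρ y)` is the dimensionless form of the
correlation function `C_o` of the initial field with correlation radius `ρ`. -/
def initialProfile (ρ : ℝ) (Co : ℝ → ℂ) (y : ℝ) : ℂ :=
  (‖Co (ρ * y)‖ : ℂ) ^ 2 / Co (ρ * 0) ^ 2

/-! ### The evolution equation -/

/-- The mixed partial derivative `∂_x^j ∂_y^k u (x, y)`. -/
def mixedDeriv (j k : ℕ) (u : ℝ → ℝ → ℂ) (x y : ℝ) : ℂ :=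
  iteratedDeriv j (fun x' => iteratedDeriv k (fun y' => u x' y') y) x

/-- `P z x y` is a classical solution for `z ≥ 0` of
`∂_z P = i ∂²_{xy} P - (1/2) (Γ(0) - Γ(x)) y² P`, `P_{z=0} = P₀`,
for which all mixed derivatives `∂_x^j ∂_y^k P` with `j, k ≤ 3` exist and are continuous
on `[0, ∞) × ℝ × ℝ`. -/
structure IsClassicalSolution (Γ : ℝ → ℝ) (P₀ : ℝ → ℝ → ℂ) (P : ℝ → ℝ → ℝ → ℂ) : Prop where
  contDiff_y : ∀ z, 0 ≤ z → ∀ x, ContDiff ℝ 3 (fun y => P z x y)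
  contDiff_x : ∀ z, 0 ≤ z → ∀ k ≤ 3, ∀ y, ContDiff ℝ 3 (fun x => mixedDeriv 0 k (P z) x y)
  continuousOn : ∀ j ≤ 3, ∀ k ≤ 3,
    ContinuousOn (fun p : ℝ × ℝ × ℝ => mixedDeriv j k (P p.1) p.2.1 p.2.2) (Ici 0 ×ˢ univ)
  pde : ∀ z, 0 < z → ∀ x y, HasDerivAt (fun t => P t x y)
    (Complex.I * mixedDeriv 1 1 (P z) x y
      - (1 / 2 : ℂ) * ((Γ 0 - Γ x : ℝ) : ℂ) * (y : ℂ) ^ 2 * P z x y) z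
  initial : ∀ x y, P 0 x y = P₀ x y

/-! ### The scintillation indices of an incoherent beam -/

/-- Scintillation index at propagation distance `z` of a partially coherent speckled beam:
`S^(pc)_z = Π̃_{z/z_c}(0,0) - 1`. -/
def scintPC (zc : ℝ) (P : ℝ → ℝ → ℝ → ℂ) (z : ℝ) : ℂ :=
  P (z / zc) 0 0 - 1

/-- Scintillation index at propagation distance `z` of a coherent speckled beam:
`S^(c)_z = 2 Π̃_{z/z_c}(0,0) - 1`. -/
def scintC (zc : ℝ) (P : ℝ → ℝ → ℝ → ℂ) (z : ℝ) : ℂ :=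
  2 * P (z / zc) 0 0 - 1

end

/-! ### Calculus lemmas -/

/-! Write `P_jk` for `∂_x^j ∂_y^k P` at the origin. The potential term carries `y²` and the factor
`Γ 0 - Γ x`, which for even `Γ` vanishes to second order at `0`. Differentiating the equation at the
origin therefore gives a short chain: `P_00' = i P_11`, `P_11' = i P_22`, `P_22' = i P_33 + Γ''(0)
P_00`. The initial datum does not depend on `x`, so `P_11`, `P_22`, `P_33` vanish at `z = 0`, while
`P_00 = 1`. Integrating three times gives `P_22 ~ c z`, `P_11 ~ i c z²/2`, `P_00 - 1 ~ -c z³/6` with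
`c = Γ''(0) = -γ̃₄`.

Two calculus facts carry this: `hasDerivAt_partial_swap` lets `∂_z` pass through the space
derivatives, and `isLittleO_pow_succ_of_hasDerivAt` integrates the error terms. Evenness of `Γ`
comes from stationarity of the medium. -/

theorem ContDiff.hasDerivAt_iteratedDeriv {F : Type*} [NormedAddCommGroup F] [NormedSpace ℝ F]
    {n k : ℕ} {f : ℝ → F} (hf : ContDiff ℝ n f) (hk : k < n) (x : ℝ) :
    HasDerivAt (iteratedDeriv k f) (iteratedDeriv (k + 1) f x) x := by
  rw [iteratedDeriv_succ]
  exact ((hf.differentiable_iteratedDeriv k (by exact_mod_cast hk)) x).hasDerivAt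

/-- Interchange of partial derivatives: if `∂_x ∂_t f` exists near a point and is continuous there,
then `∂_t ∂_x f` exists at this point and has the same value. -/
theorem hasDerivAt_partial_swap {F : Type*} [NormedAddCommGroup F] [NormedSpace ℝ F]
    {f ft fx ftx : ℝ → ℝ → F} {s : Set ℝ} (hs : IsOpen s)
    (hft : ∀ t ∈ s, ∀ x, HasDerivAt (fun t => f t x) (ft t x) t)
    (hftx : ∀ t ∈ s, ∀ x, HasDerivAt (ft t) (ftx t x) x)
    (hfx : ∀ t ∈ s, ∀ x, HasDerivAt (f t) (fx t x) x)
    {t₀ x₀ : ℝ} (ht₀ : t₀ ∈ s) (hc : ContinuousAt (fun p : ℝ × ℝ => ftx p.1 p.2) (t₀, x₀)) :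
    HasDerivAt (fun t => fx t x₀) (ftx t₀ x₀) t₀ := by
  rw [hasDerivAt_iff_isLittleO, isLittleO_iff]
  intro ε hε
  obtain ⟨d₁, hd₁, h₁⟩ := Metric.continuousAt_iff.1 hc ε hε
  obtain ⟨d₂, hd₂, h₂⟩ := Metric.isOpen_iff.1 hs t₀ ht₀
  set d := min d₁ d₂ with hd
  have hd0 : 0 < d := lt_min hd₁ hd₂
  have hsub : ∀ t ∈ Metric.ball t₀ d, t ∈ s := fun t ht =>
    h₂ (Metric.ball_subset_ball (min_le_right _ _) ht)
  have hclose : ∀ t ∈ Metric.ball t₀ d, ∀ x ∈ Metric.ball x₀ d,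
      ‖ftx t x - ftx t₀ x₀‖ ≤ ε := by
    intro t ht x hx
    rw [← dist_eq_norm]
    refine (h₁ (x := (t, x)) ?_).le
    rw [Prod.dist_eq]
    exact max_lt (lt_of_lt_of_le ht (min_le_left _ _)) (lt_of_lt_of_le hx (min_le_left _ _))
  -- The mean value inequality is applied twice to the double increment of `f`: here in `x`, then in
  -- `t` (`key` below). This bounds it by `ε |t - t₀| |x - x₀|` after subtracting its bilinear part.
  have hstep : ∀ t ∈ Metric.ball t₀ d, ∀ x ∈ Metric.ball x₀ d,
      ‖(ft t x - x • ftx t₀ x₀) - (ft t x₀ - x₀ • ftx t₀ x₀)‖ ≤ ε * ‖x - x₀‖ := by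
    intro t ht x hx
    refine (convex_ball x₀ d).norm_image_sub_le_of_norm_hasDerivWithin_le
      (f := fun x => ft t x - x • ftx t₀ x₀) (f' := fun x => ftx t x - ftx t₀ x₀)
      (fun y _ => ?_) (fun y hy => hclose t ht y hy) (Metric.mem_ball_self hd0) hx
    simpa using ((hftx t (hsub t ht) y).fun_sub
      ((hasDerivAt_id y).smul_const (ftx t₀ x₀))).hasDerivWithinAt
  filter_upwards [Metric.ball_mem_nhds t₀ hd0] with t ht
  have hder : HasDerivAt (fun x => f t x - f t₀ x - x • (t - t₀) • ftx t₀ x₀)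
      (fx t x₀ - fx t₀ x₀ - (t - t₀) • ftx t₀ x₀) x₀ := by
    simpa using ((hfx t (hsub t ht) x₀).fun_sub (hfx t₀ ht₀ x₀)).fun_sub
      ((hasDerivAt_id x₀).smul_const ((t - t₀) • ftx t₀ x₀))
  have hlip : ∀ᶠ x in 𝓝 x₀, ‖(f t x - f t₀ x - x • (t - t₀) • ftx t₀ x₀) -
      (f t x₀ - f t₀ x₀ - x₀ • (t - t₀) • ftx t₀ x₀)‖ ≤ (ε * ‖t - t₀‖) * ‖x - x₀‖ := by
    filter_upwards [Metric.ball_mem_nhds x₀ hd0] with x hx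
    have key := (convex_ball t₀ d).norm_image_sub_le_of_norm_hasDerivWithin_le
      (f := fun t => f t x - f t x₀ - t • (x - x₀) • ftx t₀ x₀)
      (f' := fun t => ft t x - ft t x₀ - (x - x₀) • ftx t₀ x₀) (C := ε * ‖x - x₀‖)
      (fun τ hτ => by
        simpa using (((hft τ (hsub τ hτ) x).fun_sub (hft τ (hsub τ hτ) x₀)).fun_sub
          ((hasDerivAt_id τ).smul_const ((x - x₀) • ftx t₀ x₀))).hasDerivWithinAt)
      (fun τ hτ => by
        convert hstep τ hτ x hx using 2
        module) (Metric.mem_ball_self hd0) ht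
    convert key using 1
    · congr 1
      module
    · ring
  -- A local Lipschitz bound at `x₀` bounds the derivative there, which turns the double increment
  -- into the desired increment of `fx` in `t`.
  have := hder.hasFDerivAt.le_of_lip' (by positivity) hlip
  simpa using this

/-- If `f` vanishes at `0`, is continuous on `[0, ∞)` and `f' = o(t ^ n)` as `t → 0⁺`, then
`f = o(t ^ (n + 1))`. -/
theorem isLittleO_pow_succ_of_hasDerivAt {F : Type*} [NormedAddCommGroup F] [NormedSpace ℝ F]
    {f f' : ℝ → F} {n : ℕ} (hf : ContinuousOn f (Ici 0)) (h0 : f 0 = 0)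
    (hf' : ∀ t, 0 < t → HasDerivAt f (f' t) t)
    (ho : f' =o[𝓝[>] 0] fun t : ℝ => t ^ n) :
    f =o[𝓝[>] 0] fun t : ℝ => t ^ (n + 1) := by
  rw [isLittleO_iff]
  intro ε hε
  obtain ⟨d, hd, h⟩ := (mem_nhdsGT_iff_exists_Ioo_subset).1 (isLittleO_iff.1 ho hε)
  filter_upwards [Ioo_mem_nhdsGT hd] with t ht
  -- No derivative is available at `0`, so the estimate starts at `s > 0`; continuity then allows `s
  -- → 0`.
  have hinterior : ∀ s ∈ Ioo 0 t, ‖f t - f s‖ ≤ ε * t ^ n * (t - s) := fun s hs =>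
    norm_image_sub_le_of_norm_deriv_le_segment' (f := f) (f' := f') (a := s) (b := t)
      (fun r hr => (hf' r (hs.1.trans_le hr.1)).hasDerivWithinAt)
      (fun r hr => by
        have hr0 : 0 < r := hs.1.trans_le hr.1
        refine (h ⟨hr0, hr.2.trans ht.2⟩ : ‖f' r‖ ≤ ε * ‖r ^ n‖).trans ?_
        rw [Real.norm_of_nonneg (by positivity)]
        gcongr
        exact hr.2.le) t ⟨hs.2.le, le_rfl⟩
  have hlim : Tendsto f (𝓝[>] 0) (𝓝 0) := by
    simpa [h0] using (hf 0 self_mem_Ici).mono_left (nhdsWithin_mono 0 Ioi_subset_Ici_self)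
  have hle : ‖f t - 0‖ ≤ ε * t ^ n * (t - 0) :=
    le_of_tendsto_of_tendsto (hlim.const_sub (f t)).norm
      ((by fun_prop : Continuous fun s : ℝ => ε * t ^ n * (t - s)).continuousAt.mono_left
        nhdsWithin_le_nhds)
      (by filter_upwards [Ioo_mem_nhdsGT ht.1] with s hs using hinterior s hs)
  rw [Real.norm_of_nonneg (pow_nonneg ht.1.le _), pow_succ, ← mul_assoc]
  simpa using hle

/-! ### The medium -/

/-- Translating by `(-z, -x)` exchanges the two points of the covariance; the sign of `z` is
absorbed by the integral. -/
theorem mediumGamma_neg {Ω : Type*} [MeasurableSpace Ω] {μ : Measure Ω} {V : ℝ → ℝ → Ω → ℝ}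
    (hV : IsRandomPotential μ V) (x : ℝ) : mediumGamma μ V (-x) = mediumGamma μ V x := by
  unfold mediumGamma
  rw [← integral_neg_eq_self]
  congr 1 with z
  simpa [mul_comm] using hV.stationary (-z) (-x) z x 0 0

theorem capGamma_neg {γ : ℝ → ℝ} (hγ : ∀ x, γ (-x) = γ x) (x : ℝ) :
    capGamma γ (-x) = capGamma γ x := by
  have h := iteratedDeriv_comp_neg 2 γ x
  simp only [hγ] at h
  simp [capGamma, h]

theorem gammaFour_eq_neg_iteratedDeriv_capGamma (γ : ℝ → ℝ) :
    gammaFour γ = -iteratedDeriv 2 (capGamma γ) 0 := by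
  have : capGamma γ = -iteratedDeriv 2 γ := rfl
  rw [this, iteratedDeriv_neg, neg_neg, gammaFour, iteratedDeriv_eq_iterate,
    iteratedDeriv_eq_iterate, iteratedDeriv_eq_iterate, ← Function.iterate_add_apply]

theorem contDiff_capGamma {γ : ℝ → ℝ} (hγ : ContDiff ℝ 4 γ) : ContDiff ℝ 2 (capGamma γ) := by
  refine ContDiff.neg ?_
  rw [iteratedDeriv_eq_iterate]
  exact ContDiff.iterate_deriv' 2 2 hγ

theorem normalizedGamma_gaussian {Ω : Type*} [MeasurableSpace Ω] {μ : Measure Ω}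
    {V : ℝ → ℝ → Ω → ℝ} {σ ℓ : ℝ} (hσ : 0 < σ) (hℓ : 0 < ℓ)
    (h : ∀ z x, ∫ ω, V 0 0 ω * V z x ω ∂μ = σ ^ 2 * Real.exp (-((x ^ 2 + z ^ 2) / ℓ ^ 2)))
    (x : ℝ) :
    normalizedGamma σ ℓ (mediumGamma μ V) x = Real.sqrt Real.pi * Real.exp (-x ^ 2) := by
  have hsplit : ∀ z, σ ^ 2 * Real.exp (-(((ℓ * x) ^ 2 + z ^ 2) / ℓ ^ 2)) =
      σ ^ 2 * Real.exp (-x ^ 2) * Real.exp (-(1 / ℓ ^ 2) * z ^ 2) := by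
    intro z
    rw [mul_assoc, ← Real.exp_add]
    congr 2
    field_simp
    ring
  have hroot : Real.sqrt (Real.pi / (1 / ℓ ^ 2)) = Real.sqrt Real.pi * ℓ := by
    rw [div_div_eq_mul_div, div_one, Real.sqrt_mul Real.pi_pos.le, Real.sqrt_sq hℓ.le]
  simp only [normalizedGamma, mediumGamma, h, hsplit]
  rw [integral_const_mul, integral_gaussian, hroot]
  field_simp

theorem gammaFour_gaussian (c : ℝ) : gammaFour (fun x => c * Real.exp (-x ^ 2)) = 12 * c := by
  have hexp : ∀ x : ℝ, HasDerivAt (fun x : ℝ => Real.exp (-x ^ 2))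
      (Real.exp (-x ^ 2) * (-(2 * x))) x := fun x => by
    simpa using ((hasDerivAt_pow 2 x).neg).exp
  -- Differentiation acts on the polynomial prefactor by `p ↦ p' - 2xp`. From `c` this yields
  -- `-2cx`, `4cx² - 2c`, `12cx - 8cx³`, whose derivatives are supplied below.
  have hmul : ∀ p p' : ℝ → ℝ, (∀ x, HasDerivAt p (p' x) x) →
      deriv (fun x => p x * Real.exp (-x ^ 2)) =
        fun x => (p' x - 2 * x * p x) * Real.exp (-x ^ 2) := fun p p' hp => by
    ext x
    rw [((hp x).fun_mul (hexp x)).deriv]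
    ring
  have hpow : ∀ (n : ℕ) (x : ℝ), HasDerivAt (fun x : ℝ => x ^ n) (n * x ^ (n - 1)) x :=
    fun n x => hasDerivAt_pow n x
  rw [gammaFour, iteratedDeriv_eq_iterate]
  simp only [Function.iterate_succ, Function.iterate_zero, Function.comp, id]
  rw [hmul (fun _ => c) (fun _ => 0) (fun x => hasDerivAt_const x c),
    hmul _ (fun _ => -2 * c) (fun x => ((hpow 1 x).const_mul (-2 * c)).congr_of_eventuallyEq
      (.of_forall fun y => by ring) |>.congr_deriv (by push_cast; ring)),
    hmul _ (fun x => 8 * c * x) (fun x => (((hpow 2 x).const_mul (4 * c)).add_const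
      (-2 * c)).congr_of_eventuallyEq (.of_forall fun y => by ring) |>.congr_deriv
        (by push_cast; ring)),
    hmul _ (fun x => 12 * c - 24 * c * x ^ 2) (fun x => (((hpow 1 x).const_mul (12 * c)).fun_add
      ((hpow 3 x).const_mul (-8 * c))).congr_of_eventuallyEq (.of_forall fun y => by ring)
        |>.congr_deriv (by push_cast; ring))]
  simp

/-! ### The evolution equation -/

namespace IsClassicalSolution

variable {Γ : ℝ → ℝ} {P₀ : ℝ → ℝ → ℂ} {P : ℝ → ℝ → ℝ → ℂ}

theorem hasDerivAt_mixedDeriv_x (hP : IsClassicalSolution Γ P₀ P) {z : ℝ} (hz : 0 ≤ z) {j k : ℕ}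
    (hj : j < 3) (hk : k ≤ 3) (x y : ℝ) :
    HasDerivAt (fun x => mixedDeriv j k (P z) x y) (mixedDeriv (j + 1) k (P z) x y) x := by
  have h := hP.contDiff_x z hz k hk y
  simp only [mixedDeriv, iteratedDeriv_zero] at h
  exact ContDiff.hasDerivAt_iteratedDeriv (n := 3) h hj x

theorem continuousAt_mixedDeriv (hP : IsClassicalSolution Γ P₀ P) {z : ℝ} (hz : 0 < z) {j k : ℕ}
    (hj : j ≤ 3) (hk : k ≤ 3) (x y : ℝ) :
    ContinuousAt (fun p : ℝ × ℝ × ℝ => mixedDeriv j k (P p.1) p.2.1 p.2.2) (z, x, y) :=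
  (hP.continuousOn j hj k hk).continuousAt (prod_mem_nhds (Ici_mem_nhds hz) univ_mem)

/-- In `mixedDeriv` the `y`-derivatives are taken first, so a further one must be commuted past each
`∂_x`, by induction on `j`. -/
theorem hasDerivAt_mixedDeriv_y (hP : IsClassicalSolution Γ P₀ P) {z : ℝ} (hz : 0 < z) {j k : ℕ}
    (hj : j ≤ 3) (hk : k < 3) (x y : ℝ) :
    HasDerivAt (fun y => mixedDeriv j k (P z) x y) (mixedDeriv j (k + 1) (P z) x y) y := by
  induction j generalizing x y with
  | zero =>
    have h := hP.contDiff_y z hz.le x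
    simp only [mixedDeriv, iteratedDeriv_zero]
    exact ContDiff.hasDerivAt_iteratedDeriv (n := 3) h hk y
  | succ j ih =>
    refine hasDerivAt_partial_swap (f := fun y x => mixedDeriv j k (P z) x y)
      (ft := fun y x => mixedDeriv j (k + 1) (P z) x y)
      (fx := fun y x => mixedDeriv (j + 1) k (P z) x y)
      (ftx := fun y x => mixedDeriv (j + 1) (k + 1) (P z) x y) isOpen_univ
      (fun y _ x => ih (by omega) x y)
      (fun y _ x => hP.hasDerivAt_mixedDeriv_x hz.le (by omega) (by omega) x y)
      (fun y _ x => hP.hasDerivAt_mixedDeriv_x hz.le (by omega) (by omega) x y) (mem_univ y) ?_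
    exact (hP.continuousAt_mixedDeriv hz hj hk x y).comp (f := fun p : ℝ × ℝ => (z, p.2, p.1))
      (x := (y, x)) (by fun_prop)

/-- Differentiation of an evolution equation in `y`. -/
theorem hasDerivAt_evolution_y (hP : IsClassicalSolution Γ P₀ P) {j k : ℕ} (hj : j ≤ 3)
    (hk : k < 3) (x : ℝ) {R R' : ℝ → ℝ → ℂ}
    (h : ∀ z, 0 < z → ∀ y, HasDerivAt (fun t => mixedDeriv j k (P t) x y) (R z y) z)
    (hR : ∀ z, 0 < z → ∀ y, HasDerivAt (R z) (R' z y) y)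
    {z : ℝ} (hz : 0 < z) {y : ℝ} (hc : ContinuousAt (fun p : ℝ × ℝ => R' p.1 p.2) (z, y)) :
    HasDerivAt (fun t => mixedDeriv j (k + 1) (P t) x y) (R' z y) z :=
  hasDerivAt_partial_swap (f := fun t y => mixedDeriv j k (P t) x y)
    (fx := fun t y => mixedDeriv j (k + 1) (P t) x y) isOpen_Ioi h hR
    (fun _ ht y => hP.hasDerivAt_mixedDeriv_y ht hj hk x y) hz hc

/-- Differentiation of an evolution equation in `x`. -/
theorem hasDerivAt_evolution_x (hP : IsClassicalSolution Γ P₀ P) {j k : ℕ} (hj : j < 3)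
    (hk : k ≤ 3) (y : ℝ) {R R' : ℝ → ℝ → ℂ}
    (h : ∀ z, 0 < z → ∀ x, HasDerivAt (fun t => mixedDeriv j k (P t) x y) (R z x) z)
    (hR : ∀ z, 0 < z → ∀ x, HasDerivAt (R z) (R' z x) x)
    {z : ℝ} (hz : 0 < z) {x : ℝ} (hc : ContinuousAt (fun p : ℝ × ℝ => R' p.1 p.2) (z, x)) :
    HasDerivAt (fun t => mixedDeriv (j + 1) k (P t) x y) (R' z x) z :=
  hasDerivAt_partial_swap (f := fun t x => mixedDeriv j k (P t) x y)
    (fx := fun t x => mixedDeriv (j + 1) k (P t) x y) isOpen_Ioi h hR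
    (fun _ ht x => hP.hasDerivAt_mixedDeriv_x (le_of_lt ht) hj hk x y) hz hc

theorem continuousAt_mixedDeriv_zx (hP : IsClassicalSolution Γ P₀ P) {z : ℝ} (hz : 0 < z)
    {j k : ℕ} (hj : j ≤ 3) (hk : k ≤ 3) (x y : ℝ) :
    ContinuousAt (fun p : ℝ × ℝ => mixedDeriv j k (P p.1) p.2 y) (z, x) :=
  (hP.continuousAt_mixedDeriv hz hj hk x y).comp (f := fun p : ℝ × ℝ => (p.1, p.2, y))
    (x := (z, x)) (by fun_prop)

theorem continuousAt_mixedDeriv_zy (hP : IsClassicalSolution Γ P₀ P) {z : ℝ} (hz : 0 < z)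
    {j k : ℕ} (hj : j ≤ 3) (hk : k ≤ 3) (x y : ℝ) :
    ContinuousAt (fun p : ℝ × ℝ => mixedDeriv j k (P p.1) x p.2) (z, y) :=
  (hP.continuousAt_mixedDeriv hz hj hk x y).comp (f := fun p : ℝ × ℝ => (p.1, x, p.2))
    (x := (z, y)) (by fun_prop)

theorem continuousOn_mixedDeriv_z (hP : IsClassicalSolution Γ P₀ P)
    {j k : ℕ} (hj : j ≤ 3) (hk : k ≤ 3) (x y : ℝ) :
    ContinuousOn (fun z : ℝ => mixedDeriv j k (P z) x y) (Ici 0) :=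
  (hP.continuousOn j hj k hk).comp (f := fun z : ℝ => (z, x, y)) (by fun_prop)
    (fun _ hz => ⟨hz, mem_univ _⟩)

/-! ### Evolution in `z` of the mixed derivatives -/

theorem hasDerivAt_mixedDeriv_zero_zero (hP : IsClassicalSolution Γ P₀ P) {z : ℝ} (hz : 0 < z)
    (x y : ℝ) :
    HasDerivAt (fun t => mixedDeriv 0 0 (P t) x y)
      (Complex.I * mixedDeriv 1 1 (P z) x y
        - (1 / 2 : ℂ) * ((Γ 0 - Γ x : ℝ) : ℂ) * ((y : ℂ) ^ 2 * mixedDeriv 0 0 (P z) x y)) z := by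
  have h := hP.pde z hz x y
  simp only [mixedDeriv, iteratedDeriv_zero] at h ⊢
  convert h using 1
  ring

theorem hasDerivAt_mixedDeriv_zero_one (hP : IsClassicalSolution Γ P₀ P) {z : ℝ} (hz : 0 < z)
    (x y : ℝ) :
    HasDerivAt (fun t => mixedDeriv 0 1 (P t) x y)
      (Complex.I * mixedDeriv 1 2 (P z) x y - (1 / 2 : ℂ) * ((Γ 0 - Γ x : ℝ) : ℂ) *
        (2 * y * mixedDeriv 0 0 (P z) x y + (y : ℂ) ^ 2 * mixedDeriv 0 1 (P z) x y)) z := by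
  refine hP.hasDerivAt_evolution_y (j := 0) (k := 0) (by norm_num) (by norm_num) x
    (R' := fun z y => Complex.I * mixedDeriv 1 2 (P z) x y - (1 / 2 : ℂ) *
      ((Γ 0 - Γ x : ℝ) : ℂ) * (2 * y * mixedDeriv 0 0 (P z) x y +
        (y : ℂ) ^ 2 * mixedDeriv 0 1 (P z) x y))
    (fun z hz y => hP.hasDerivAt_mixedDeriv_zero_zero hz x y) (fun z hz y => ?_) hz ?_
  · have hy : HasDerivAt (fun y : ℝ => (y : ℂ) ^ 2) (2 * y) y := by
      simpa using (hasDerivAt_id y).ofReal_comp.fun_pow 2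
    exact ((hP.hasDerivAt_mixedDeriv_y hz (by norm_num) (by norm_num) x y).const_mul _).fun_sub
      ((hy.fun_mul (hP.hasDerivAt_mixedDeriv_y hz (by norm_num) (by norm_num) x y)).const_mul _)
  · have h₀ := hP.continuousAt_mixedDeriv_zy hz (j := 0) (k := 0) (by norm_num) (by norm_num) x y
    have h₁ := hP.continuousAt_mixedDeriv_zy hz (j := 0) (k := 1) (by norm_num) (by norm_num) x y
    have h₂ := hP.continuousAt_mixedDeriv_zy hz (j := 1) (k := 2) (by norm_num) (by norm_num) x y
    fun_prop

theorem hasDerivAt_mixedDeriv_zero_two (hP : IsClassicalSolution Γ P₀ P) {z : ℝ} (hz : 0 < z)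
    (x y : ℝ) :
    HasDerivAt (fun t => mixedDeriv 0 2 (P t) x y)
      (Complex.I * mixedDeriv 1 3 (P z) x y - (1 / 2 : ℂ) * ((Γ 0 - Γ x : ℝ) : ℂ) *
        (2 * mixedDeriv 0 0 (P z) x y + 4 * y * mixedDeriv 0 1 (P z) x y +
          (y : ℂ) ^ 2 * mixedDeriv 0 2 (P z) x y)) z := by
  refine hP.hasDerivAt_evolution_y (j := 0) (k := 1) (by norm_num) (by norm_num) x
    (R' := fun z y => Complex.I * mixedDeriv 1 3 (P z) x y - (1 / 2 : ℂ) *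
      ((Γ 0 - Γ x : ℝ) : ℂ) * (2 * mixedDeriv 0 0 (P z) x y + 4 * y * mixedDeriv 0 1 (P z) x y +
        (y : ℂ) ^ 2 * mixedDeriv 0 2 (P z) x y))
    (fun z hz y => hP.hasDerivAt_mixedDeriv_zero_one hz x y) (fun z hz y => ?_) hz ?_
  · have hy₁ : HasDerivAt (fun y : ℝ => 2 * (y : ℂ)) 2 y := by
      simpa using (hasDerivAt_id y).ofReal_comp.const_mul (2 : ℂ)
    have hy : HasDerivAt (fun y : ℝ => (y : ℂ) ^ 2) (2 * y) y := by
      simpa using (hasDerivAt_id y).ofReal_comp.fun_pow 2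
    have h := ((hP.hasDerivAt_mixedDeriv_y hz (j := 1) (k := 2) (by norm_num) (by norm_num)
        x y).const_mul Complex.I).fun_sub
      (((hy₁.fun_mul (hP.hasDerivAt_mixedDeriv_y hz (j := 0) (k := 0) (by norm_num) (by norm_num)
        x y)).fun_add (hy.fun_mul (hP.hasDerivAt_mixedDeriv_y hz (j := 0) (k := 1) (by norm_num)
        (by norm_num) x y))).const_mul ((1 / 2 : ℂ) * ((Γ 0 - Γ x : ℝ) : ℂ)))
    refine h.congr_deriv ?_
    ring
  · have h₀ := hP.continuousAt_mixedDeriv_zy hz (j := 0) (k := 0) (by norm_num) (by norm_num) x y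
    have h₁ := hP.continuousAt_mixedDeriv_zy hz (j := 0) (k := 1) (by norm_num) (by norm_num) x y
    have h₂ := hP.continuousAt_mixedDeriv_zy hz (j := 0) (k := 2) (by norm_num) (by norm_num) x y
    have h₃ := hP.continuousAt_mixedDeriv_zy hz (j := 1) (k := 3) (by norm_num) (by norm_num) x y
    fun_prop

/-- The factor `y²` and its first derivative vanish at `y = 0`, so the potential does not contribute
at this order. -/
theorem hasDerivAt_mixedDeriv_one_one (hP : IsClassicalSolution Γ P₀ P) {z : ℝ} (hz : 0 < z)
    (x : ℝ) :
    HasDerivAt (fun t => mixedDeriv 1 1 (P t) x 0) (Complex.I * mixedDeriv 2 2 (P z) x 0) z := by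
  refine hP.hasDerivAt_evolution_x (j := 0) (k := 1) (by norm_num) (by norm_num) 0
    (R := fun z x => Complex.I * mixedDeriv 1 2 (P z) x 0)
    (R' := fun z x => Complex.I * mixedDeriv 2 2 (P z) x 0)
    (fun z hz x => by simpa using hP.hasDerivAt_mixedDeriv_zero_one hz x 0)
    (fun z hz x => (hP.hasDerivAt_mixedDeriv_x hz.le (by norm_num) (by norm_num) x 0).const_mul _)
    hz ?_
  exact continuousAt_const.mul
    (hP.continuousAt_mixedDeriv_zx hz (by norm_num) (by norm_num) x 0)

theorem hasDerivAt_mixedDeriv_one_two (hP : IsClassicalSolution Γ P₀ P) (hΓ : ContDiff ℝ 2 Γ)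
    {z : ℝ} (hz : 0 < z) (x : ℝ) :
    HasDerivAt (fun t => mixedDeriv 1 2 (P t) x 0)
      (Complex.I * mixedDeriv 2 3 (P z) x 0 + ((iteratedDeriv 1 Γ x : ℝ) : ℂ) *
        mixedDeriv 0 0 (P z) x 0 - ((Γ 0 - Γ x : ℝ) : ℂ) * mixedDeriv 1 0 (P z) x 0) z := by
  refine hP.hasDerivAt_evolution_x (j := 0) (k := 2) (by norm_num) (by norm_num) 0
    (R := fun z x => Complex.I * mixedDeriv 1 3 (P z) x 0 -
      ((Γ 0 - Γ x : ℝ) : ℂ) * mixedDeriv 0 0 (P z) x 0)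
    (R' := fun z x => Complex.I * mixedDeriv 2 3 (P z) x 0 + ((iteratedDeriv 1 Γ x : ℝ) : ℂ) *
        mixedDeriv 0 0 (P z) x 0 - ((Γ 0 - Γ x : ℝ) : ℂ) * mixedDeriv 1 0 (P z) x 0)
    (fun z hz x => by
      convert hP.hasDerivAt_mixedDeriv_zero_two hz x 0 using 1
      simp
      ring) (fun z hz x => ?_) hz ?_
  · have hG : HasDerivAt (fun x => ((Γ 0 - Γ x : ℝ) : ℂ)) ((-iteratedDeriv 1 Γ x : ℝ) : ℂ) x := by
      have := ContDiff.hasDerivAt_iteratedDeriv (n := 2) (k := 0) hΓ (by norm_num) x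
      simp only [iteratedDeriv_zero] at this
      exact (this.const_sub (Γ 0)).ofReal_comp
    have h := ((hP.hasDerivAt_mixedDeriv_x hz.le (j := 1) (k := 3) (by norm_num) (by norm_num)
      x 0).const_mul Complex.I).fun_sub (hG.fun_mul (hP.hasDerivAt_mixedDeriv_x hz.le (j := 0) (k := 0)
        (by norm_num) (by norm_num) x 0))
    refine h.congr_deriv ?_
    push_cast
    ring
  · have h₀ := hP.continuousAt_mixedDeriv_zx hz (j := 0) (k := 0) (by norm_num) (by norm_num) x 0
    have h₁ := hP.continuousAt_mixedDeriv_zx hz (j := 1) (k := 0) (by norm_num) (by norm_num) x 0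
    have h₂ := hP.continuousAt_mixedDeriv_zx hz (j := 2) (k := 3) (by norm_num) (by norm_num) x 0
    have hΓ₀ : Continuous Γ := hΓ.continuous
    have hΓ₁ : Continuous (iteratedDeriv 1 Γ) := hΓ.continuous_iteratedDeriv 1 (by norm_num)
    fun_prop

/-- Two `y`-derivatives of `y²` cancel the factor `1/2`. Of the Leibniz terms in `x`, only the one
with `Γ''` survives at `0`, as `Γ'(0) = 0` by evenness. -/
theorem hasDerivAt_mixedDeriv_two_two (hP : IsClassicalSolution Γ P₀ P) (hΓ : ContDiff ℝ 2 Γ)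
    (heven : ∀ x, Γ (-x) = Γ x) {z : ℝ} (hz : 0 < z) :
    HasDerivAt (fun t => mixedDeriv 2 2 (P t) 0 0)
      (Complex.I * mixedDeriv 3 3 (P z) 0 0 +
        ((iteratedDeriv 2 Γ 0 : ℝ) : ℂ) * mixedDeriv 0 0 (P z) 0 0) z := by
  have hΓ₁0 : iteratedDeriv 1 Γ 0 = 0 := by
    have h := iteratedDeriv_comp_neg 1 Γ 0
    simp only [heven, neg_zero, pow_one, neg_smul, one_smul] at h
    linarith
  have h : HasDerivAt (fun t => mixedDeriv 2 2 (P t) 0 0)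
      (Complex.I * mixedDeriv 3 3 (P z) 0 0 + ((iteratedDeriv 2 Γ 0 : ℝ) : ℂ) *
        mixedDeriv 0 0 (P z) 0 0 + 2 * ((iteratedDeriv 1 Γ 0 : ℝ) : ℂ) * mixedDeriv 1 0 (P z) 0 0
        - ((Γ 0 - Γ 0 : ℝ) : ℂ) * mixedDeriv 2 0 (P z) 0 0) z := by
    refine hP.hasDerivAt_evolution_x (j := 1) (k := 2) (by norm_num) (by norm_num) 0
      (R' := fun z x => Complex.I * mixedDeriv 3 3 (P z) x 0 + ((iteratedDeriv 2 Γ x : ℝ) : ℂ) *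
        mixedDeriv 0 0 (P z) x 0 + 2 * ((iteratedDeriv 1 Γ x : ℝ) : ℂ) * mixedDeriv 1 0 (P z) x 0
        - ((Γ 0 - Γ x : ℝ) : ℂ) * mixedDeriv 2 0 (P z) x 0)
      (fun z hz x => hP.hasDerivAt_mixedDeriv_one_two hΓ hz x) (fun z hz x => ?_) hz ?_
    · have hG : HasDerivAt (fun x => ((Γ 0 - Γ x : ℝ) : ℂ))
          ((-iteratedDeriv 1 Γ x : ℝ) : ℂ) x := by
        have := ContDiff.hasDerivAt_iteratedDeriv (n := 2) (k := 0) hΓ (by norm_num) x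
        simp only [iteratedDeriv_zero] at this
        exact (this.const_sub (Γ 0)).ofReal_comp
      have hG₁ : HasDerivAt (fun x => ((iteratedDeriv 1 Γ x : ℝ) : ℂ))
          ((iteratedDeriv 2 Γ x : ℝ) : ℂ) x :=
        (ContDiff.hasDerivAt_iteratedDeriv (n := 2) (k := 1) hΓ (by norm_num) x).ofReal_comp
      have h := (((hP.hasDerivAt_mixedDeriv_x hz.le (j := 2) (k := 3) (by norm_num) (by norm_num)
        x 0).const_mul Complex.I).fun_add (hG₁.fun_mul (hP.hasDerivAt_mixedDeriv_x hz.le (j := 0) (k := 0)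
          (by norm_num) (by norm_num) x 0))).fun_sub (hG.fun_mul (hP.hasDerivAt_mixedDeriv_x hz.le
          (j := 1) (k := 0) (by norm_num) (by norm_num) x 0))
      refine h.congr_deriv ?_
      push_cast
      ring
    · have h₀ := hP.continuousAt_mixedDeriv_zx hz (j := 0) (k := 0) (by norm_num) (by norm_num) 0 0
      have h₁ := hP.continuousAt_mixedDeriv_zx hz (j := 1) (k := 0) (by norm_num) (by norm_num) 0 0
      have h₂ := hP.continuousAt_mixedDeriv_zx hz (j := 2) (k := 0) (by norm_num) (by norm_num) 0 0
      have h₃ := hP.continuousAt_mixedDeriv_zx hz (j := 3) (k := 3) (by norm_num) (by norm_num) 0 0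
      have hΓ₀ : Continuous Γ := hΓ.continuous
      have hΓ₁ : Continuous (iteratedDeriv 1 Γ) := hΓ.continuous_iteratedDeriv 1 (by norm_num)
      have hΓ₂ : Continuous (iteratedDeriv 2 Γ) := hΓ.continuous_iteratedDeriv 2 (by norm_num)
      fun_prop
  simpa [hΓ₁0] using h

theorem mixedDeriv_initial {p : ℝ → ℂ} (hP : IsClassicalSolution Γ (fun _ y => p y) P) {j k : ℕ}
    (hj : j ≠ 0) (x y : ℝ) : mixedDeriv j k (P 0) x y = 0 := by
  have h : P 0 = fun _ y => p y := by
    ext x y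
    exact hP.initial x y
  rw [h]
  simp [mixedDeriv, iteratedDeriv_const, hj]

/-- Expansion of the on-axis value of the solution for small propagation distances. -/
theorem isLittleO_axis {p : ℝ → ℂ} (hP : IsClassicalSolution Γ (fun _ y => p y) P) (hp : p 0 = 1)
    (hΓ : ContDiff ℝ 2 Γ) (heven : ∀ x, Γ (-x) = Γ x) :
    (fun z : ℝ => P z 0 0 - 1 - ((-iteratedDeriv 2 Γ 0 / 6 * z ^ 3 : ℝ) : ℂ))
      =o[𝓝[>] 0] fun z : ℝ => z ^ 3 := by
  set c : ℂ := ((iteratedDeriv 2 Γ 0 : ℝ) : ℂ) with hc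
  have hpow : ∀ (n : ℕ) (z : ℝ), HasDerivAt (fun z : ℝ => (z : ℂ) ^ n) (n * (z : ℂ) ^ (n - 1)) z :=
    fun n z => by simpa using (hasDerivAt_id z).ofReal_comp.fun_pow n
  have hcont : ∀ {j k : ℕ}, j ≤ 3 → k ≤ 3 →
      ContinuousOn (fun z => mixedDeriv j k (P z) 0 0) (Ici 0) :=
    fun hj hk => hP.continuousOn_mixedDeriv_z hj hk 0 0
  have h00 : mixedDeriv 0 0 (P 0) 0 0 = 1 := by
    simp [mixedDeriv, hP.initial, hp]
  -- Continuity up to `z = 0` closes the chain: the uncontrolled `P_33` tends to its initial value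
  -- `0`. Each step below gains one power of `z`.
  have h₃ : (fun z => Complex.I * mixedDeriv 3 3 (P z) 0 0 + c * mixedDeriv 0 0 (P z) 0 0 - c)
      =o[𝓝[>] 0] fun z : ℝ => z ^ 0 := by
    simp only [pow_zero]
    rw [isLittleO_one_iff]
    have hcts : ContinuousOn (fun z => Complex.I * mixedDeriv 3 3 (P z) 0 0 +
        c * mixedDeriv 0 0 (P z) 0 0 - c) (Ici 0) :=
      ((continuousOn_const.mul (hcont le_rfl le_rfl)).add
        (continuousOn_const.mul (hcont (by norm_num) (by norm_num)))).sub continuousOn_const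
    have := (hcts 0 self_mem_Ici).mono_left (nhdsWithin_mono 0 Ioi_subset_Ici_self)
    simpa [h00, hP.mixedDeriv_initial] using this
  have h₂ : (fun z : ℝ => mixedDeriv 2 2 (P z) 0 0 - c * (z : ℂ)) =o[𝓝[>] 0]
      fun z : ℝ => z ^ 1 := by
    refine isLittleO_pow_succ_of_hasDerivAt
      ((hcont (by norm_num) (by norm_num)).sub (by fun_prop))
      (by simp [hP.mixedDeriv_initial]) (fun z hz => ?_) h₃
    simpa using (hP.hasDerivAt_mixedDeriv_two_two hΓ heven hz).fun_sub ((hpow 1 z).const_mul c)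
  have h₁ : (fun z : ℝ => mixedDeriv 1 1 (P z) 0 0 - Complex.I * c / 2 * (z : ℂ) ^ 2) =o[𝓝[>] 0]
      fun z : ℝ => z ^ 2 := by
    refine isLittleO_pow_succ_of_hasDerivAt
      ((hcont (by norm_num) (by norm_num)).sub (by fun_prop))
      (by simp [hP.mixedDeriv_initial]) (fun z hz => ?_) (h₂.const_mul_left Complex.I)
    refine ((hP.hasDerivAt_mixedDeriv_one_one hz 0).fun_sub
      ((hpow 2 z).const_mul (Complex.I * c / 2))).congr_deriv ?_
    push_cast
    ring
  have h₀ : (fun z : ℝ => mixedDeriv 0 0 (P z) 0 0 - 1 + c / 6 * (z : ℂ) ^ 3) =o[𝓝[>] 0]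
      fun z : ℝ => z ^ 3 := by
    refine isLittleO_pow_succ_of_hasDerivAt
      (((hcont (by norm_num) (by norm_num)).sub continuousOn_const).add (by fun_prop))
      (by simp [h00]) (fun z hz => ?_) (h₁.const_mul_left Complex.I)
    refine (((hP.hasDerivAt_mixedDeriv_zero_zero hz 0 0).sub_const 1).fun_add
      ((hpow 3 z).const_mul (c / 6))).congr_deriv ?_
    push_cast
    linear_combination (c / 2 * (z : ℂ) ^ 2) * Complex.I_mul_I
  convert h₀ using 2 with z
  simp [mixedDeriv, hc]
  ring

end IsClassicalSolution

theorem initialProfile_zero {ρ : ℝ} {Co : ℝ → ℂ} (hre : 0 < (Co 0).re) (him : (Co 0).im = 0) :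
    initialProfile ρ Co 0 = 1 := by
  have h : Co 0 = ((Co 0).re : ℂ) := Complex.ext (by simp) (by simp [him])
  have hne : ((Co 0).re : ℂ) ≠ 0 := by exact_mod_cast hre.ne'
  rw [initialProfile, mul_zero, h, Complex.norm_real, Real.norm_of_nonneg hre.le]
  exact div_self (pow_ne_zero 2 hne)

theorem mainTheorem4 {Ω : Type*} [MeasurableSpace Ω] (μ : Measure Ω) [IsProbabilityMeasure μ]
    (V : ℝ → ℝ → Ω → ℝ) (hV : IsRandomPotential μ V)
    (α σ ℓ : ℝ) (hα : 0 < α) (hσ : 0 < σ) (hℓ : 0 < ℓ) :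
    -- the expansions for a smooth medium and any initial field
    (ContDiff ℝ 4 (mediumGamma μ V) →
      gammaFour (normalizedGamma σ ℓ (mediumGamma μ V)) =
          -iteratedDeriv 2 (capGamma (normalizedGamma σ ℓ (mediumGamma μ V))) 0 ∧
      ∀ (ρ : ℝ) (_ : 0 < ρ) (Co : ℝ → ℂ) (_ : 0 < (Co 0).re) (_ : (Co 0).im = 0)
        (P : ℝ → ℝ → ℝ → ℂ)
        (_ : IsClassicalSolution (capGamma (normalizedGamma σ ℓ (mediumGamma μ V)))
          (fun _ y => initialProfile ρ Co (y / xInit α σ ρ)) P),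
        ((fun z : ℝ => scintPC (zCrit α σ ℓ) P z -
            ((gammaFour (normalizedGamma σ ℓ (mediumGamma μ V)) / 6 *
              (z / zCrit α σ ℓ) ^ 3 : ℝ) : ℂ))
          =o[𝓝[>] 0] fun z : ℝ => (z / zCrit α σ ℓ) ^ 3) ∧
        ((fun z : ℝ => scintC (zCrit α σ ℓ) P z -
            ((1 + gammaFour (normalizedGamma σ ℓ (mediumGamma μ V)) / 3 *
              (z / zCrit α σ ℓ) ^ 3 : ℝ) : ℂ))
          =o[𝓝[>] 0] fun z : ℝ => (z / zCrit α σ ℓ) ^ 3)) ∧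
    -- the medium with Gaussian correlation function
    ((∀ z x, ∫ ω, V 0 0 ω * V z x ω ∂μ = σ ^ 2 * Real.exp (-((x ^ 2 + z ^ 2) / ℓ ^ 2))) →
      (∀ x, normalizedGamma σ ℓ (mediumGamma μ V) x =
          Real.sqrt Real.pi * Real.exp (-x ^ 2)) ∧
      gammaFour (normalizedGamma σ ℓ (mediumGamma μ V)) = 12 * Real.sqrt Real.pi) := by
  constructor
  · intro hγ
    set γt := normalizedGamma σ ℓ (mediumGamma μ V) with hγt
    have hsmooth : ContDiff ℝ 4 γt :=
      (hγ.comp (contDiff_const.mul contDiff_id)).div_const _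
    have heven : ∀ x, γt (-x) = γt x := fun x => by
      simp only [hγt, normalizedGamma, mul_neg, mediumGamma_neg hV]
    have hfour := gammaFour_eq_neg_iteratedDeriv_capGamma γt
    refine ⟨hfour, fun ρ _ Co hre him P hP => ?_⟩
    have hzc : 0 < zCrit α σ ℓ := by unfold zCrit; positivity
    have hlim : Tendsto (fun z : ℝ => z / zCrit α σ ℓ) (𝓝[>] 0) (𝓝[>] 0) := by
      refine tendsto_nhdsWithin_iff.2 ⟨?_, ?_⟩
      · have : Continuous fun z : ℝ => z / zCrit α σ ℓ := by fun_prop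
        simpa using (this.tendsto 0).mono_left nhdsWithin_le_nhds
      · filter_upwards [self_mem_nhdsWithin] with z hz
        exact div_pos hz hzc
    have h := (hP.isLittleO_axis (p := fun y => initialProfile ρ Co (y / xInit α σ ρ))
      (by simpa using initialProfile_zero hre him) (contDiff_capGamma hsmooth)
      (capGamma_neg heven)).comp_tendsto hlim
    rw [← hfour] at h
    -- The coherent remainder is exactly twice the partially coherent one.
    refine ⟨h, (h.const_mul_left 2).congr_left fun z => ?_⟩
    simp only [Function.comp, scintC]
    push_cast
    ring
  · intro hg
    have h := normalizedGamma_gaussian hσ hℓ hg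
    refine ⟨h, ?_⟩
    rw [funext h]
    exact gammaFour_gaussian _
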